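/- An ordered hypergraph $G$ on a finite linearly ordered set $V(G)$ is given by a set $E(G)$ of subsets of $V(G)$, its edges (without repetition). Its weight is $i(G)=\sum_{E\in E(G)}|E|$. We say that $G$ contains an ordered hypergraph $H$ if there are an order-preserving injection $f:V(H)\to V(G)$ and an injection $g:E(H)\to E(G)$ such that $f(v)\in g(E)$ whenever $E\in E(H)$ and $v\in E$; otherwise $G$ avoids $H$. For a positive integer $d$, a $d$-permutation hypergraph is a hypergraph on $[kd]=\{1,\dots,kd\}$, for some positive integer $k$, with exactly $k$ edges, each of size $d$, such that each vertex lies in exactly one edge and each edge has exactly one vertex in each of the intervals $\{1,\dots,k\},\{k+1,\dots,2k\},\dots,\{(d-1)k+1,\dots,dk\}$. Theorem 5.3. Let $d\ge 2$ be an integer and let $H$ be a $d$-permutation hypergraph. Then there is a constant $C$, depending only on $H$, such that for every positive integer $n$ and every hypergraph $G$ on $[n]$ that avoids $H$, $$i(G)\le C\,n^{d-1}.$$ -/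

import Mathlib

namespace Hypergraph

/-- For hypergraphs with linearly ordered vertices, `G` contains `H` if there are an
order-preserving injection of vertex sets and an injection of edge sets (both from `H` to `G`)
such that every vertex of an edge `E` of `H` is sent to a vertex of the image of `E`. The image of
`E` may have further vertices. -/
def Contains {α β : Type*} [LinearOrder α] [LinearOrder β]
    (G : Hypergraph α) (H : Hypergraph β) : Prop :=
  ∃ (f : H.vertexSet ↪o G.vertexSet) (g : H.edgeSet ↪ G.edgeSet),
    ∀ (E : H.edgeSet) (v : H.vertexSet), (v : β) ∈ (E : Set β) → (f v : α) ∈ (g E : Set α)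

/-- `G` avoids `H` if it does not contain `H`. -/
def Avoids {α β : Type*} [LinearOrder α] [LinearOrder β]
    (G : Hypergraph α) (H : Hypergraph β) : Prop :=
  ¬ G.Contains H

/-- The weight `i(G) = ∑ |E|`, summed over the edges `E` of `G`, for a hypergraph on a finite vertex
set (which then has finitely many edges, all of them finite). -/
noncomputable def weight {α : Type*} (G : Hypergraph α) : ℕ :=
  ∑ᶠ E ∈ G.edgeSet, Set.ncard E

/-- A `d`-permutation hypergraph: for some positive `k`, its vertex set is `{1, …, kd}`, it has `k`
edges, each of size `d`, every vertex lies in exactly one edge, and every edge has exactly one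
vertex in each of the intervals `{jk + 1, …, (j + 1)k}`, `0 ≤ j < d`. -/
def IsPermutationHypergraph (d : ℕ) (H : Hypergraph ℕ) : Prop :=
  ∃ k : ℕ, 0 < k ∧
    H.vertexSet = Set.Icc 1 (k * d) ∧
    H.edgeSet.encard = k ∧
    (∀ E ∈ H.edgeSet, E.encard = d) ∧
    (∀ v ∈ H.vertexSet, ∃! E : Set ℕ, E ∈ H.edgeSet ∧ v ∈ E) ∧
    (∀ E ∈ H.edgeSet, ∀ j < d, ∃! v : ℕ, v ∈ E ∧ v ∈ Set.Icc (j * k + 1) ((j + 1) * k))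

end Hypergraph

/-!
The proof follows the contraction method of Marcus and Tardos, in arrays whose dimension may exceed
that of the pattern.

Let `M ⊆ [n]^ι` be an array such that for every set `J` of `d + 1` coordinates, some pattern is not
realized by the projection of `M` to `J`. Then `|M| = O(n ^ d)`
(`exists_card_le_of_not_realizes`). For `d = 0` each coordinate takes boundedly many values. For the
induction step, cut `[n]^ι` into blocks of constant side `t`. The array of nonempty blocks again
realizes none of the patterns. A block is wide in direction `j` if its cells take at least as many
values in that coordinate as the pattern has entries. A block that is not wide in any direction has
at most `c` cells, with `c` independent of `t`. Blocks which are wide in direction `j`, at the same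
position and with the same values there, cannot realize on a set `J'` of `d` further coordinates the
pattern of `insert j J'`, since the values in direction `j` could be chosen freely
(`Realizes.insert_of_residues`); by induction there are `O(n ^ (d - 1))` of them for each position,
hence `O(n ^ d)` wide blocks. So the maximum `f` satisfies `f(n) ≤ c * f(n / t) + O(n ^ d)`,
and a large `t` gives the bound.

A family of `s`-sets is an `s`-dimensional array of increasing tuples. Realizing the pattern of `H`
on `d` of the coordinates is not yet a copy of `H`, because the images of different intervals of
`H` may interleave; adding one entry per coordinate to the pattern prevents this
(`Hypergraph.IsCoordinates.containedIn_of_realizes`). So a uniform family avoiding `H` has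
`O(n ^ (d - 1))` members.

Finally, let `p` be the number of vertices of `H`. The edges of size less than `p` are treated for
each size separately. A larger edge is cut into consecutive pieces of size `p`. A set of size `p` is
contained in fewer than `k` edges, as `k` of them would give a copy of `H`, and for `d ≥ 2` the
family of pieces still avoids `H`, because any two edges of `H` interleave while two pieces of one
edge do not (`Hypergraph.IsCoordinates.not_containedIn_biUnion`). Thus the weight is at most a
constant multiple of the size of a `p`-uniform family avoiding `H`.
-/

/-! ### Arrays avoiding patterns -/

section Arrays

open Finset

variable {ι A : Type*}

/-- The array `M` (a set of cells, with `ι`-indexed coordinates) realizes the pattern `r` on the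
coordinates `J` if it has cells `m a`, `a ∈ A`, which for every `j ∈ J` have their `j`-th
coordinates in the same strict order as the ranks `r j a`. Ties between ranks impose no
condition, and the coordinates outside `J` are free. -/
def Realizes (M : Finset (ι → ℕ)) (J : Finset ι) (r : ι → A → ℕ) : Prop :=
  ∃ m : A → ι → ℕ, (∀ a, m a ∈ M) ∧ ∀ j ∈ J, ∀ a b, r j a < r j b → m a j < m b j

/-- An array is contained in the box spanned by its coordinate projections. -/
theorem card_le_pow_of_card_image_le [Fintype ι] [DecidableEq ι] (M : Finset (ι → ℕ)) (K : ℕ)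
    (h : ∀ i, #(M.image fun x => x i) ≤ K) : #M ≤ K ^ Fintype.card ι := by
  have hM : M ⊆ Fintype.piFinset fun i => M.image (· i) := fun x hx =>
    Fintype.mem_piFinset.2 fun i => mem_image_of_mem _ hx
  calc #M ≤ ∏ i, #(M.image (· i)) := (card_le_card hM).trans_eq (Fintype.card_piFinset _)
    _ ≤ ∏ _i : ι, K := prod_le_prod' fun i _ => h i
    _ = K ^ Fintype.card ι := by simp

/-- The elements of a large enough set can be used to imitate the order of the ranks `r`. -/
theorem exists_mem_of_rank [Fintype A] (r : A → ℕ) (Q : Finset ℕ)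
    (hQ : Fintype.card A ≤ #Q) :
    ∃ q : A → ℕ, (∀ a, q a ∈ Q) ∧ ∀ a b, r a < r b → q a < q b := by
  have hlt : ∀ a, #(univ.filter fun b => r b < r a) < #Q := fun a =>
    (card_lt_univ_of_notMem (x := a) (by simp)).trans_le hQ
  refine ⟨fun a => Q.orderEmbOfFin rfl ⟨_, hlt a⟩, fun a => Q.orderEmbOfFin_mem rfl _,
    fun a b hab => ?_⟩
  rw [OrderEmbedding.lt_iff_lt, Fin.mk_lt_mk]
  refine card_lt_card ⟨fun c hc => ?_, fun h => ?_⟩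
  · simp only [mem_filter, mem_univ, true_and] at hc ⊢
    omega
  · have := h (mem_filter.2 ⟨mem_univ a, hab⟩)
    simp at this

theorem realizes_of_card_le_card_image [Fintype A] (M : Finset (ι → ℕ)) (j : ι) (r : ι → A → ℕ)
    (h : Fintype.card A ≤ #(M.image fun x => x j)) : Realizes M {j} r := by
  obtain ⟨q, hq, hlt⟩ := exists_mem_of_rank (r j) _ h
  choose m hm hmq using fun a => mem_image.1 (hq a)
  refine ⟨m, hm, fun i hi a b hab => ?_⟩
  obtain rfl := mem_singleton.1 hi
  rw [hmq, hmq]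
  exact hlt a b hab

variable [Fintype ι]

/-- The coordinatewise image of an array under `x ↦ x / t`. -/
def contract (t : ℕ) (M : Finset (ι → ℕ)) : Finset (ι → ℕ) :=
  M.image fun x i => x i / t

/-- The cells of `M` which are contracted to `B`. -/
def fibre (t : ℕ) (M : Finset (ι → ℕ)) (B : ι → ℕ) : Finset (ι → ℕ) :=
  M.filter fun x => (fun i => x i / t) = B

/-- The positions, within the block `B`, of the `j`-th coordinates of the cells of `M` in `B`. -/
def residues (t : ℕ) (M : Finset (ι → ℕ)) (B : ι → ℕ) (j : ι) : Finset ℕ :=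
  (fibre t M B).image fun x => x j % t

theorem Realizes.of_contract {t : ℕ} {M : Finset (ι → ℕ)} {J : Finset ι} {r : ι → A → ℕ}
    (h : Realizes (contract t M) J r) : Realizes M J r := by
  obtain ⟨m, hm, hlt⟩ := h
  choose x hx hxm using fun a => mem_image.1 (hm a)
  refine ⟨x, hx, fun j hj a b hab => ?_⟩
  have := hlt j hj a b hab
  rw [← hxm a, ← hxm b] at this
  exact lt_of_not_ge fun hle => this.not_ge (Nat.div_le_div_right hle)

/-- If blocks with the same `j`-th coordinate and the same large set of residues in direction `j`
realize a pattern on `J`, then choosing the residues freely in these blocks realizes it on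
`insert j J`. -/
theorem Realizes.insert_of_residues [DecidableEq ι] [Fintype A] {t β : ℕ}
    {M N : Finset (ι → ℕ)} {J : Finset ι} {j : ι} {r : ι → A → ℕ} {Q : Finset ℕ}
    (hQ : Fintype.card A ≤ #Q)
    (hN : ∀ B ∈ N, B j = β ∧ residues t M B j = Q) (h : Realizes N J r) :
    Realizes M (insert j J) r := by
  obtain ⟨m, hm, hlt⟩ := h
  obtain ⟨q, hq, hqlt⟩ := exists_mem_of_rank (r j) Q hQ
  have hmem : ∀ a, ∃ x ∈ fibre t M (m a), x j % t = q a := fun a => by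
    have := hq a
    rw [← (hN _ (hm a)).2] at this
    exact mem_image.1 this
  choose x hx hxq using hmem
  have hdiv : ∀ a i, x a i / t = m a i := fun a i => congrFun (mem_filter.1 (hx a)).2 i
  refine ⟨x, fun a => (mem_filter.1 (hx a)).1, fun i hi a b hab => ?_⟩
  by_cases hij : i = j
  · subst hij
    have e : ∀ a, x a i = t * β + q a := fun a => by
      rw [← hxq a, ← (hN _ (hm a)).1, ← hdiv, Nat.div_add_mod]
    rw [e, e]
    exact Nat.add_lt_add_left (hqlt a b hab) _
  · have := hlt i (mem_of_mem_insert_of_ne hi hij) a b hab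
    rw [← hdiv, ← hdiv] at this
    exact lt_of_not_ge fun hle => this.not_ge (Nat.div_le_div_right hle)

theorem card_image_fibre_le_card_residues (t : ℕ) (M : Finset (ι → ℕ)) (B : ι → ℕ) (j : ι) :
    #((fibre t M B).image fun x => x j) ≤ #(residues t M B j) := by
  refine (card_le_card (t := (residues t M B j).image fun q => t * B j + q) ?_).trans card_image_le
  intro y hy
  obtain ⟨x, hx, rfl⟩ := mem_image.1 hy
  refine mem_image.2 ⟨x j % t, mem_image_of_mem _ hx, ?_⟩
  have : x j / t = B j := congrFun (mem_filter.1 hx).2 j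
  rw [← this, Nat.div_add_mod]

theorem residues_subset_range {t : ℕ} (ht : 0 < t) (M : Finset (ι → ℕ)) (B : ι → ℕ) (j : ι) :
    residues t M B j ⊆ range t := by
  intro y hy
  obtain ⟨x, -, rfl⟩ := mem_image.1 hy
  exact mem_range.2 (Nat.mod_lt _ ht)

theorem card_fibre_le [DecidableEq ι] {t : ℕ} (ht : 0 < t) (M : Finset (ι → ℕ)) (B : ι → ℕ) :
    #(fibre t M B) ≤ t ^ Fintype.card ι :=
  card_le_pow_of_card_image_le _ _ fun i =>
    (card_image_fibre_le_card_residues t M B i).trans <| by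
      simpa using card_le_card (residues_subset_range ht M B i)

/-- A block whose residue sets are all smaller than `K` has a number of cells bounded independently
of the side `t` of the block. -/
theorem card_fibre_le_of_card_residues_lt [DecidableEq ι] {t K : ℕ} (M : Finset (ι → ℕ))
    (S : Finset ι) (hS : ∀ x ∈ M, ∀ y ∈ M, ∀ i ∉ S, x i = y i) (B : ι → ℕ)
    (h : ∀ j ∈ S, #(residues t M B j) < K) :
    #(fibre t M B) ≤ (K + 1) ^ Fintype.card ι := by
  refine card_le_pow_of_card_image_le _ _ fun i => ?_
  by_cases hi : i ∈ S
  · have := card_image_fibre_le_card_residues t M B i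
    have := h i hi
    omega
  · refine (card_le_one.2 fun a ha b hb => ?_).trans (Nat.le_add_left 1 K)
    obtain ⟨x, hx, rfl⟩ := mem_image.1 ha
    obtain ⟨y, hy, rfl⟩ := mem_image.1 hb
    exact hS x (mem_filter.1 hx).1 y (mem_filter.1 hy).1 i hi

/-- The blocks whose set of residues is large in some direction `j ∈ S` are few, if for each `j`,
position `β` and residue set `Q` there are at most `c j` of them. -/
theorem card_wide_le [DecidableEq ι] {t n' K : ℕ} (ht : 0 < t) (M : Finset (ι → ℕ))
    (S : Finset ι) (c : ι → ℕ) (hn : ∀ B ∈ contract t M, ∀ i, B i < n')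
    (hc : ∀ j ∈ S, ∀ β, ∀ Q : Finset ℕ, K ≤ #Q →
      #((contract t M).filter fun B => B j = β ∧ residues t M B j = Q) ≤ c j) :
    #((contract t M).filter fun B => ∃ j ∈ S, K ≤ #(residues t M B j)) ≤
      ∑ j ∈ S, n' * (2 ^ t * c j) := by
  let T : ι → ℕ → Finset ℕ → Finset (ι → ℕ) := fun j β Q =>
    (contract t M).filter fun B => (B j = β ∧ residues t M B j = Q) ∧ K ≤ #Q
  have hT : ∀ j ∈ S, ∀ β Q, #(T j β Q) ≤ c j := fun j hj β Q => by
    by_cases hQ : K ≤ #Q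
    · exact (card_le_card fun B hB => by
        simp only [T, mem_filter] at hB ⊢
        exact ⟨hB.1, hB.2.1⟩).trans (hc j hj β Q hQ)
    · simp [T, hQ]
  have hsub : ((contract t M).filter fun B => ∃ j ∈ S, K ≤ #(residues t M B j)) ⊆
      S.biUnion fun j => (range n').biUnion fun β => (range t).powerset.biUnion fun Q =>
        T j β Q := by
    intro B hB
    obtain ⟨hB, j, hj, hK⟩ := mem_filter.1 hB
    simp only [mem_biUnion]
    exact ⟨j, hj, B j, mem_range.2 (hn B hB j), residues t M B j,
      mem_powerset.2 (residues_subset_range ht M B j), mem_filter.2 ⟨hB, ⟨rfl, rfl⟩, hK⟩⟩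
  refine (card_le_card hsub).trans <| card_biUnion_le.trans <| sum_le_sum fun j hj => ?_
  refine (card_biUnion_le_card_mul _ _ (2 ^ t * c j) fun β _ => ?_).trans_eq (by simp)
  exact (card_biUnion_le_card_mul _ _ (c j) fun Q _ => hT j hj β Q).trans_eq (by simp)

/-- A multidimensional Marcus–Tardos theorem: if for every set `J` of `d + 1` coordinates some
pattern on `A` is not realized on `J`, then the array has `O(n ^ d)` cells. The set `S` collects
the coordinates which are allowed to vary, so that fixing a coordinate in the induction on `d` does
not change the index type. -/
theorem exists_card_le_of_not_realizes [DecidableEq ι] (A : Type*) [Fintype A] (d : ℕ) :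
    ∀ S : Finset ι, ∃ C : ℕ, ∀ n : ℕ, 0 < n → ∀ M : Finset (ι → ℕ),
      (∀ x ∈ M, ∀ i, x i < n) → (∀ x ∈ M, ∀ y ∈ M, ∀ i ∉ S, x i = y i) →
      ∀ r : Finset ι → ι → A → ℕ, (∀ J ⊆ S, #J = d + 1 → ¬ Realizes M J (r J)) →
        #M ≤ C * n ^ d := by
  induction d with
  | zero =>
    refine fun S => ⟨(Fintype.card A + 1) ^ Fintype.card ι, fun n _ M _ hS r h => ?_⟩
    rw [pow_zero, mul_one]
    refine card_le_pow_of_card_image_le _ _ fun i => ?_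
    by_cases hi : i ∈ S
    · by_contra! hlt
      exact h {i} (singleton_subset_iff.2 hi) (card_singleton i)
        (realizes_of_card_le_card_image M i _ (by omega))
    · refine (card_le_one.2 fun a ha b hb => ?_).trans (Nat.le_add_left 1 _)
      obtain ⟨x, hx, rfl⟩ := mem_image.1 ha
      obtain ⟨y, hy, rfl⟩ := mem_image.1 hb
      exact hS x hx y hy i hi
  | succ d ih =>
    intro S
    choose C' hC' using ih
    set e := Fintype.card ι
    set c := (Fintype.card A + 1) ^ e
    -- A block that is not wide has at most `c` cells, so blocks of side `t > 4 * c` make the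
    -- contribution of these blocks at most half of the bound: there are about `n / t` positions in
    -- each direction, the factor `4` pays for rounding `n / t` up and for the half.
    obtain ⟨t, ht⟩ : ∃ t, t = 4 * (c + 1) := ⟨_, rfl⟩
    have ht0 : 0 < t := by omega
    obtain ⟨D, hD⟩ : ∃ D, D = ∑ j ∈ S, 2 ^ t * C' (S.erase j) * t ^ e := ⟨_, rfl⟩
    refine ⟨2 * D + t ^ e, fun n => ?_⟩
    induction n using Nat.strong_induction_on with
    | _ n ihn =>
    intro hn M hM hS r h
    rcases le_or_gt n t with hnt | hnt
    · have h1 : #M ≤ n ^ e := card_le_pow_of_card_image_le _ _ fun i => by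
        refine (card_le_card (t := range n) fun y hy => ?_).trans_eq (card_range n)
        obtain ⟨x, hx, rfl⟩ := mem_image.1 hy
        exact mem_range.2 (hM x hx i)
      have h2 : n ^ e ≤ t ^ e := Nat.pow_le_pow_left hnt e
      have h3 : 1 ≤ n ^ (d + 1) := Nat.one_le_pow _ _ hn
      nlinarith
    obtain ⟨n', hn'⟩ : ∃ n', n' = n / t + 1 := ⟨_, rfl⟩
    -- Rounding up costs at most a factor `2`, because `t < n`.
    have hn't : n' * (2 * (c + 1)) ≤ n := by
      have := Nat.div_mul_le_self n t
      have : n' * t ≤ 2 * n := by rw [hn', add_mul]; omega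
      rw [ht] at this
      linarith
    have hn'0 : 0 < n' := hn' ▸ Nat.succ_pos _
    have hn'n : n' < n := by nlinarith
    have hM' : ∀ B ∈ contract t M, ∀ i, B i < n' := fun B hB i => by
      obtain ⟨x, hx, rfl⟩ := mem_image.1 hB
      rw [hn', Nat.lt_succ_iff]
      exact Nat.div_le_div_right (hM x hx i).le
    have hS' : ∀ x ∈ contract t M, ∀ y ∈ contract t M, ∀ i ∉ S, x i = y i := by
      intro x hx y hy i hi
      obtain ⟨u, hu, rfl⟩ := mem_image.1 hx
      obtain ⟨v, hv, rfl⟩ := mem_image.1 hy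
      simp only [hS u hu v hv i hi]
    have hcontract : #(contract t M) ≤ (2 * D + t ^ e) * n' ^ (d + 1) :=
      ihn n' hn'n hn'0 _ hM' hS' r fun J hJ hcard hreal =>
        h J hJ hcard hreal.of_contract
    -- Wide blocks with a common position and residue set in direction `j` form an array in which
    -- the `j`-th coordinate is fixed, and which avoids patterns on `d + 1` coordinates.
    have hwide := card_wide_le (K := Fintype.card A) ht0 M S
      (fun j => C' (S.erase j) * n' ^ d) hM' fun j hj β Q hQ => by
        refine hC' (S.erase j) n' hn'0 _ (fun B hB => hM' B (mem_filter.1 hB).1)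
          (fun x hx y hy i hi => ?_) (fun J => r (insert j J)) ?_
        · by_cases hij : i = j
          · rw [hij, (mem_filter.1 hx).2.1, (mem_filter.1 hy).2.1]
          · exact hS' x (mem_filter.1 hx).1 y (mem_filter.1 hy).1 i fun hiS =>
              hi (mem_erase.2 ⟨hij, hiS⟩)
        · intro J hJ hcard hreal
          have hjJ : j ∉ J := fun hjJ => (mem_erase.1 (hJ hjJ)).1 rfl
          exact h (insert j J) (insert_subset hj (hJ.trans (erase_subset _ _)))
            (by rw [card_insert_of_notMem hjJ, hcard])
            (hreal.insert_of_residues hQ fun B hB => (mem_filter.1 hB).2)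
    have hsum : #M = ∑ B ∈ contract t M, #(fibre t M B) :=
      card_eq_sum_card_image _ _
    rw [← sum_filter_add_sum_filter_not _
      (fun B => ∃ j ∈ S, Fintype.card A ≤ #(residues t M B j))] at hsum
    have h1 := sum_le_card_nsmul ((contract t M).filter fun B =>
      ∃ j ∈ S, Fintype.card A ≤ #(residues t M B j)) (fun B => #(fibre t M B)) (t ^ e)
      fun B _ => card_fibre_le ht0 M B
    have h2 := sum_le_card_nsmul ((contract t M).filter fun B =>
      ¬ ∃ j ∈ S, Fintype.card A ≤ #(residues t M B j)) (fun B => #(fibre t M B)) c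
      fun B hB => card_fibre_le_of_card_residues_lt M S hS B fun j hj => by
        by_contra! hle
        exact (mem_filter.1 hB).2 ⟨j, hj, hle⟩
    have h3 : #((contract t M).filter fun B =>
      ¬ ∃ j ∈ S, Fintype.card A ≤ #(residues t M B j)) ≤ (2 * D + t ^ e) * n' ^ (d + 1) :=
      (card_filter_le _ _).trans hcontract
    rw [smul_eq_mul] at h1 h2
    have h4 : (∑ j ∈ S, n' * (2 ^ t * (C' (S.erase j) * n' ^ d))) * t ^ e =
        D * n' ^ (d + 1) := by
      rw [hD, sum_mul, sum_mul]
      exact sum_congr rfl fun j _ => by ring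
    have h5 : n' ^ (d + 1) ≤ n ^ (d + 1) := Nat.pow_le_pow_left hn'n.le _
    have h6 : n' ^ (d + 1) * (2 * c) ≤ n ^ (d + 1) :=
      calc n' ^ (d + 1) * (2 * c) ≤ n' ^ (d + 1) * (2 * (c + 1)) ^ (d + 1) := by
            gcongr
            calc 2 * c ≤ (2 * (c + 1)) ^ 1 := by rw [pow_one]; omega
              _ ≤ (2 * (c + 1)) ^ (d + 1) := Nat.pow_le_pow_right (by omega) (by omega)
        _ = (n' * (2 * (c + 1))) ^ (d + 1) := (mul_pow _ _ _).symm
        _ ≤ n ^ (d + 1) := Nat.pow_le_pow_left hn't _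
    have h7 := (Nat.mul_le_mul_right (t ^ e) hwide).trans_eq h4
    have h8 := Nat.mul_le_mul_right c h3
    have h9 := Nat.mul_le_mul_left (2 * D + t ^ e) h6
    have h10 := Nat.mul_le_mul_left D h5
    have h11 : 0 ≤ t ^ e * n ^ (d + 1) := Nat.zero_le _
    nlinarith

end Arrays

/-! ### Uniform families avoiding a permutation hypergraph -/

namespace Hypergraph

open Finset

/-- The family `𝒢` of finite sets contains `H`, expressed by total functions: `F` maps the vertices
of `H` monotonically and `g` maps the edges of `H` injectively to members of `𝒢`. -/
def ContainedIn (H : Hypergraph ℕ) (𝒢 : Finset (Finset ℕ)) : Prop :=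
  ∃ F : ℕ → ℕ, StrictMonoOn F H.vertexSet ∧ ∃ g : Set ℕ → Finset ℕ, Set.InjOn g H.edgeSet ∧
    ∀ E ∈ H.edgeSet, g E ∈ 𝒢 ∧ ∀ v ∈ E, F v ∈ g E

theorem ContainedIn.mono {H : Hypergraph ℕ} {𝒢 𝒢' : Finset (Finset ℕ)} (h : H.ContainedIn 𝒢)
    (hsub : 𝒢 ⊆ 𝒢') : H.ContainedIn 𝒢' := by
  obtain ⟨F, hF, g, hg, hm⟩ := h
  exact ⟨F, hF, g, hg, fun E hE => ⟨hsub (hm E hE).1, (hm E hE).2⟩⟩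

/-- Coordinates for a `d`-permutation hypergraph with `k` edges: `v E j` is the vertex of the edge
`E` in the interval `{jk + 1, …, (j + 1)k}`. -/
structure IsCoordinates (H : Hypergraph ℕ) (d k : ℕ) (v : Set ℕ → ℕ → ℕ) : Prop where
  vertexSet_eq : H.vertexSet = Set.Icc 1 (k * d)
  finite : H.edgeSet.Finite
  ncard_eq : H.edgeSet.ncard = k
  mem : ∀ E ∈ H.edgeSet, ∀ j < d, v E j ∈ E
  lower : ∀ E ∈ H.edgeSet, ∀ j < d, j * k < v E j
  upper : ∀ E ∈ H.edgeSet, ∀ j < d, v E j ≤ (j + 1) * k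
  eq_of_mem : ∀ E ∈ H.edgeSet, ∀ w ∈ E, ∃ j < d, v E j = w
  exists_mem : ∀ w ∈ H.vertexSet, ∃ E ∈ H.edgeSet, w ∈ E
  unique : ∀ E ∈ H.edgeSet, ∀ E' ∈ H.edgeSet, ∀ w, w ∈ E → w ∈ E' → E = E'

theorem IsPermutationHypergraph.exists_isCoordinates {d : ℕ} {H : Hypergraph ℕ}
    (hH : H.IsPermutationHypergraph d) : ∃ k, 0 < k ∧ ∃ v, H.IsCoordinates d k v := by
  obtain ⟨k, hk, hV, hcard, -, huniq, hint⟩ := hH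
  choose! v hv hvu using hint
  refine ⟨k, hk, v, hV, Set.finite_of_encard_eq_coe hcard, by simp [Set.ncard, hcard],
    fun E hE j hj => (hv E hE j hj).1, fun E hE j hj => (hv E hE j hj).2.1,
    fun E hE j hj => (hv E hE j hj).2.2, fun E hE w hw => ?_,
    fun w hw => (huniq w hw).exists, fun E hE E' hE' w hw hw' =>
      (huniq w (mem_vertexSet_of_mem_edgeSet hE hw)).unique ⟨hE, hw⟩ ⟨hE', hw'⟩⟩
  have hwV := mem_vertexSet_of_mem_edgeSet hE hw
  rw [hV, Set.mem_Icc] at hwV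
  have hj : (w - 1) / k < d := (Nat.div_lt_iff_lt_mul hk).2 (by rw [mul_comm]; omega)
  refine ⟨(w - 1) / k, hj, (hvu E hE _ hj w ⟨hw, ?_⟩).symm⟩
  have h1 := Nat.div_mul_le_self (w - 1) k
  have h2 := Nat.lt_div_mul_add (a := w - 1) hk
  rw [Set.mem_Icc, add_mul]
  omega

namespace IsCoordinates

variable {H : Hypergraph ℕ} {d k : ℕ} {v : Set ℕ → ℕ → ℕ}

theorem lt_of_lt (hv : H.IsCoordinates d k v) {E E' : Set ℕ} (hE : E ∈ H.edgeSet)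
    (hE' : E' ∈ H.edgeSet) {j j' : ℕ} (hjj' : j < j') (hj' : j' < d) : v E j < v E' j' :=
  (hv.upper E hE j (hjj'.trans hj')).trans_lt <|
    (Nat.mul_le_mul_right k hjj').trans_lt (hv.lower E' hE' j' hj')

/-- To find a copy of `H` it suffices to place each vertex `v E j` at some `φ E j` in the image of
`E`: every vertex lies in exactly one edge, so the placements cannot conflict. -/
theorem containedIn_of_lt (hv : H.IsCoordinates d k v) {𝒢 : Finset (Finset ℕ)}
    (φ : Set ℕ → ℕ → ℕ) (g : Set ℕ → Finset ℕ) (hg : Set.InjOn g H.edgeSet)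
    (hmem : ∀ E ∈ H.edgeSet, g E ∈ 𝒢 ∧ ∀ j < d, φ E j ∈ g E)
    (hlt : ∀ E ∈ H.edgeSet, ∀ E' ∈ H.edgeSet, ∀ j < d, ∀ j' < d, v E j < v E' j' →
      φ E j < φ E' j') : H.ContainedIn 𝒢 := by
  have hex : ∀ w ∈ H.vertexSet, ∃ E ∈ H.edgeSet, ∃ j < d, v E j = w := fun w hw => by
    obtain ⟨E, hE, hwE⟩ := hv.exists_mem w hw
    exact ⟨E, hE, hv.eq_of_mem E hE w hwE⟩
  choose! e he c hc hec using hex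
  refine ⟨fun w => φ (e w) (c w), fun w hw w' hw' hww' => ?_, g, hg, fun E hE =>
    ⟨(hmem E hE).1, fun w hwE => ?_⟩⟩
  · exact hlt _ (he w hw) _ (he w' hw') _ (hc w hw) _ (hc w' hw')
      (by rwa [hec w hw, hec w' hw'])
  · have hw := mem_vertexSet_of_mem_edgeSet hE hwE
    have : e w = E := hv.unique _ (he w hw) _ hE w
      (by simpa only [hec w hw] using hv.mem _ (he w hw) _ (hc w hw)) hwE
    simpa only [this] using (hmem E hE).2 _ (hc w hw)

/-- The pattern of `H`, with one additional entry for each coordinate `l`. It is the top entry in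
coordinate `l` and at the bottom in the other ones. In an array of increasing tuples it forces the
`l`-th coordinate of every entry coming from `H` to lie below all later coordinates of all entries
coming from `H`. -/
noncomputable def separatedPattern (H : Hypergraph ℕ) (d k : ℕ) (v : Set ℕ → ℕ → ℕ) (j : Fin d) :
    H.edgeSet ⊕ Fin d → ℕ
  | .inl E => v E j
  | .inr l => if l = j then k * d + 1 else 0

/-- Here the cells of `M` are the increasing enumerations of members of `𝒢`. Realizing the separated
pattern makes the images of the `d` intervals of `H` consecutive, which a realization of the
pattern of `H` alone would not. -/
theorem containedIn_of_realizes [NeZero d] (hv : H.IsCoordinates d k v)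
    {𝒢 : Finset (Finset ℕ)} {s : ℕ} {M : Finset (Fin s → ℕ)}
    (hM : ∀ x ∈ M, StrictMono x ∧ univ.image x ∈ 𝒢)
    {J : Finset (Fin s)} (hJ : #J = d) {r : Fin s → H.edgeSet ⊕ Fin d → ℕ}
    (hr : ∀ j, r (J.orderEmbOfFin hJ j) = separatedPattern H d k v j) (h : Realizes M J r) :
    H.ContainedIn 𝒢 := by
  classical
  obtain ⟨m, hm, hlt⟩ := h
  set e := J.orderEmbOfFin hJ
  have hlt' : ∀ j a b, separatedPattern H d k v j a < separatedPattern H d k v j b →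
      m a (e j) < m b (e j) := fun j a b hab =>
    hlt (e j) (J.orderEmbOfFin_mem hJ j) a b (by rwa [hr])
  have hsep : ∀ j j' : Fin d, j < j' → ∀ E E' : H.edgeSet,
      m (.inl E) (e j) < m (.inl E') (e j') := by
    intro j j' hjj' E E'
    calc m (.inl E) (e j) < m (.inr j) (e j) := hlt' _ _ _ <| by
          simp only [separatedPattern, if_true]
          calc v E j ≤ (j + 1) * k := hv.upper E E.2 j j.2
            _ ≤ d * k := Nat.mul_le_mul_right k j.2
            _ < k * d + 1 := by rw [mul_comm]; exact Nat.lt_succ_self _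
      _ < m (.inr j) (e j') := (hM _ (hm _)).1 (e.lt_iff_lt.2 hjj')
      _ < m (.inl E') (e j') := hlt' _ _ _ <| by
          simp only [separatedPattern, if_neg hjj'.ne]
          exact (Nat.zero_le _).trans_lt (hv.lower E' E'.2 j' j'.2)
  have hmono : ∀ j j' : Fin d, ∀ E E' : H.edgeSet, v E j < v E' j' →
      m (.inl E) (e j) < m (.inl E') (e j') := by
    intro j j' E E' hvv
    rcases lt_trichotomy j j' with hjj' | rfl | hjj'
    · exact hsep j j' hjj' E E'
    · exact hlt' j _ _ hvv
    · exact absurd hvv (hv.lt_of_lt E'.2 E.2 hjj' j.2).not_gt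
  refine hv.containedIn_of_lt
    (fun E j => if h : E ∈ H.edgeSet ∧ j < d then m (.inl ⟨E, h.1⟩) (e ⟨j, h.2⟩) else 0)
    (fun E => if h : E ∈ H.edgeSet then univ.image (m (.inl ⟨E, h⟩)) else ∅)
    (fun E hE E' hE' hEE' => ?_) (fun E hE => ⟨?_, fun j hj => ?_⟩)
    fun E hE E' hE' j hj j' hj' hvv => ?_
  · simp only [dif_pos hE, dif_pos hE'] at hEE'
    -- Increasing tuples with the same underlying set are equal.
    have hmm : m (.inl ⟨E, hE⟩) = m (.inl ⟨E', hE'⟩) := by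
      refine (StrictMono.range_inj (hM _ (hm _)).1 (hM _ (hm _)).1).1 ?_
      simpa using congrArg (fun T : Finset ℕ => (T : Set ℕ)) hEE'
    have h0 : 0 < d := Nat.pos_of_neZero d
    rcases lt_trichotomy (v E 0) (v E' 0) with hlt0 | heq | hlt0
    · exact absurd (hmono ⟨0, h0⟩ ⟨0, h0⟩ ⟨E, hE⟩ ⟨E', hE'⟩ hlt0) (by rw [hmm]; exact lt_irrefl _)
    · exact hv.unique E hE E' hE' _ (hv.mem E hE 0 h0) (heq ▸ hv.mem E' hE' 0 h0)
    · exact absurd (hmono ⟨0, h0⟩ ⟨0, h0⟩ ⟨E', hE'⟩ ⟨E, hE⟩ hlt0) (by rw [hmm]; exact lt_irrefl _)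
  · simpa only [dif_pos hE] using (hM _ (hm _)).2
  · simp only [dif_pos hE, dif_pos (And.intro hE hj)]
    exact mem_image_of_mem _ (mem_univ _)
  · simp only [dif_pos (And.intro hE hj), dif_pos (And.intro hE' hj')]
    exact hmono ⟨j, hj⟩ ⟨j', hj'⟩ ⟨E, hE⟩ ⟨E', hE'⟩ hvv

/-- The bound for families of sets of a fixed size `s`, viewed as arrays of dimension `s`. The size
`s` need not be related to `d`. -/
theorem exists_card_le_of_uniform [NeZero d] (hv : H.IsCoordinates d k v) (s : ℕ) :
    ∃ C : ℕ, ∀ n : ℕ, 0 < n → ∀ 𝒢 : Finset (Finset ℕ),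
      (∀ E ∈ 𝒢, #E = s ∧ ∀ x ∈ E, x < n) → ¬ H.ContainedIn 𝒢 → #𝒢 ≤ C * n ^ (d - 1) := by
  classical
  have := hv.finite.fintype
  obtain ⟨C, hC⟩ := exists_card_le_of_not_realizes (H.edgeSet ⊕ Fin d) (d - 1)
    (univ : Finset (Fin s))
  refine ⟨C, fun n hn 𝒢 h𝒢 hnot => ?_⟩
  let M : Finset (Fin s → ℕ) := (Fintype.piFinset fun _ => range n).filter fun x =>
    StrictMono x ∧ univ.image x ∈ 𝒢
  have hsub : 𝒢 ⊆ M.image fun x => univ.image x := fun E hE => by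
    have hEM : univ.image (E.orderEmbOfFin (h𝒢 E hE).1) = E := E.image_orderEmbOfFin_univ _
    refine mem_image.2 ⟨E.orderEmbOfFin (h𝒢 E hE).1, mem_filter.2
      ⟨Fintype.mem_piFinset.2 fun i => mem_range.2 ((h𝒢 E hE).2 _ (E.orderEmbOfFin_mem _ i)),
        OrderEmbedding.strictMono _, by rwa [hEM]⟩, hEM⟩
  refine (card_le_card hsub).trans <| card_image_le.trans <| hC n hn M
    (fun x hx i => mem_range.1 (Fintype.mem_piFinset.1 (mem_filter.1 hx).1 i))
    (fun x _ y _ i hi => absurd (mem_univ i) hi)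
    (fun J => if h : #J = d then
      Function.extend (J.orderEmbOfFin h) (separatedPattern H d k v) 0 else 0)
    fun J _ hcard hreal => hnot ?_
  have hJ : #J = d := by have := Nat.pos_of_neZero d; omega
  rw [dif_pos hJ] at hreal
  exact hv.containedIn_of_realizes (fun x hx => (mem_filter.1 hx).2) hJ
    (fun j => (J.orderEmbOfFin hJ).injective.extend_apply _ _ j) hreal

end IsCoordinates

/-! ### Cutting large edges into pieces -/

theorem exists_initial_segment {α : Type*} [LinearOrder α] (E : Finset α) (p : ℕ) (hp : p ≤ #E) :
    ∃ T ⊆ E, #T = p ∧ ∀ x ∈ T, ∀ y ∈ E \ T, x < y := by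
  induction p with
  | zero => exact ⟨∅, by simp⟩
  | succ p ih =>
    obtain ⟨T, hTE, hT, hlt⟩ := ih (by omega)
    have hne : (E \ T).Nonempty := by
      rw [← card_pos, card_sdiff_of_subset hTE]
      omega
    have hmin := min'_mem _ hne
    refine ⟨insert ((E \ T).min' hne) T, insert_subset (mem_sdiff.1 hmin).1 hTE, ?_, ?_⟩
    · rw [card_insert_of_notMem (mem_sdiff.1 hmin).2, hT]
    · intro x hx y hy
      rw [mem_sdiff, mem_insert, not_or] at hy
      have hy' : y ∈ E \ T := mem_sdiff.2 ⟨hy.1, hy.2.2⟩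
      rcases mem_insert.1 hx with rfl | hx
      · exact lt_of_le_of_ne (min'_le _ _ hy') (Ne.symm hy.2.1)
      · exact hlt x hx y hy'

/-- A finite set can be cut into consecutive pieces of size `p`, up to a remainder of less than `p`
elements. -/
theorem exists_pieces {α : Type*} [LinearOrder α] {p : ℕ} (hp : 0 < p) (E : Finset α) :
    ∃ 𝒯 : Finset (Finset α), (∀ T ∈ 𝒯, T ⊆ E ∧ #T = p) ∧
      (∀ T ∈ 𝒯, ∀ T' ∈ 𝒯, T ≠ T' → (∀ x ∈ T, ∀ y ∈ T', x < y) ∨ ∀ x ∈ T, ∀ y ∈ T', y < x) ∧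
      #E < p * (#𝒯 + 1) := by
  induction E using Finset.strongInduction with
  | H E ih =>
    rcases lt_or_ge #E p with hE | hE
    · exact ⟨∅, by simp, by simp, by simpa⟩
    obtain ⟨T, hTE, hT, hlt⟩ := exists_initial_segment E p hE
    have hTne : T.Nonempty := card_pos.1 (hT ▸ hp)
    obtain ⟨𝒯, h1, h2, h3⟩ := ih (E \ T) (sdiff_ssubset hTE hTne)
    have hT𝒯 : T ∉ 𝒯 := fun h => by
      obtain ⟨x, hx⟩ := hTne
      exact (mem_sdiff.1 ((h1 T h).1 hx)).2 hx
    refine ⟨insert T 𝒯, ?_, ?_, ?_⟩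
    · intro T' hT'
      rcases mem_insert.1 hT' with rfl | hT'
      · exact ⟨hTE, hT⟩
      · exact ⟨(h1 T' hT').1.trans sdiff_subset, (h1 T' hT').2⟩
    · intro T₁ h₁ T₂ h₂ hne
      rcases mem_insert.1 h₁ with rfl | h₁' <;> rcases mem_insert.1 h₂ with rfl | h₂'
      · exact absurd rfl hne
      · exact .inl fun x hx y hy => hlt x hx y ((h1 _ h₂').1 hy)
      · exact .inr fun x hx y hy => hlt y hy x ((h1 _ h₁').1 hx)
      · exact h2 _ h₁' _ h₂' hne
    · rw [card_insert_of_notMem hT𝒯]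
      rw [card_sdiff_of_subset hTE, hT] at h3
      calc #E < p + p * (#𝒯 + 1) := by omega
        _ = p * (#𝒯 + 1 + 1) := by ring

namespace IsCoordinates

variable {H : Hypergraph ℕ} {d k : ℕ} {v : Set ℕ → ℕ → ℕ}

/-- A set with as many elements as `H` has vertices lies in fewer than `k` members of a family that
does not contain `H`. -/
theorem card_filter_superset_lt (hv : H.IsCoordinates d k v) {𝒢 : Finset (Finset ℕ)}
    (hnot : ¬ H.ContainedIn 𝒢) {T : Finset ℕ} (hT : #T = k * d) :
    #(𝒢.filter fun E => T ⊆ E) < k := by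
  by_contra! hle
  have := hv.finite.fintype
  have hcard : Fintype.card H.edgeSet = k := by
    rw [← hv.ncard_eq, Set.ncard_eq_toFinset_card', Set.toFinset_card]
  obtain ⟨g⟩ : Nonempty (H.edgeSet ↪ 𝒢.filter fun E => T ⊆ E) :=
    Function.Embedding.nonempty_of_card_le (by rwa [Fintype.card_coe, hcard])
  classical
  have hg : ∀ E : H.edgeSet, (g E : Finset ℕ) ∈ 𝒢 ∧ T ⊆ g E := fun E =>
    mem_filter.1 (g E).2
  have hV : ∀ w ∈ H.vertexSet, w - 1 < k * d := fun w hw => by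
    rw [hv.vertexSet_eq, Set.mem_Icc] at hw
    omega
  refine hnot ⟨fun w => if h : w - 1 < k * d then T.orderEmbOfFin hT ⟨w - 1, h⟩ else 0,
    fun w hw w' hw' hlt => ?_,
    fun E => if h : E ∈ H.edgeSet then g ⟨E, h⟩ else ∅, fun E hE E' hE' hEE' => ?_,
    fun E hE => ⟨?_, fun w hw => ?_⟩⟩
  · simp only [dif_pos (hV w hw), dif_pos (hV w' hw'), OrderEmbedding.lt_iff_lt, Fin.mk_lt_mk]
    rw [hv.vertexSet_eq, Set.mem_Icc] at hw
    omega
  · simp only [dif_pos hE, dif_pos hE'] at hEE'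
    exact congrArg Subtype.val (g.injective (Subtype.ext hEE'))
  · simpa only [dif_pos hE] using (hg ⟨E, hE⟩).1
  · simp only [dif_pos hE, dif_pos (hV w (mem_vertexSet_of_mem_edgeSet hE hw))]
    exact (hg ⟨E, hE⟩).2 (T.orderEmbOfFin_mem hT _)

/-- Replacing the members of a family by pieces of them creates no copy of `H`: two edges of `H`
interleave, so their images cannot be two separated pieces of the same set. -/
theorem not_containedIn_biUnion (hv : H.IsCoordinates d k v) (hd : 2 ≤ d)
    {𝒢 : Finset (Finset ℕ)} (hnot : ¬ H.ContainedIn 𝒢) (𝒯 : Finset ℕ → Finset (Finset ℕ))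
    (hsub : ∀ E ∈ 𝒢, ∀ T ∈ 𝒯 E, T ⊆ E)
    (hsep : ∀ E ∈ 𝒢, ∀ T ∈ 𝒯 E, ∀ T' ∈ 𝒯 E, T ≠ T' →
      (∀ x ∈ T, ∀ y ∈ T', x < y) ∨ ∀ x ∈ T, ∀ y ∈ T', y < x) :
    ¬ H.ContainedIn (𝒢.biUnion 𝒯) := by
  rintro ⟨F, hF, g, hg, hmem⟩
  choose! e he hge using fun E hE => mem_biUnion.1 (hmem E hE).1
  refine hnot ⟨F, hF, e, fun E hE E' hE' hEE' => ?_, fun E hE =>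
    ⟨he E hE, fun w hw => hsub _ (he E hE) _ (hge E hE) ((hmem E hE).2 w hw)⟩⟩
  by_contra hne
  have hin : ∀ E ∈ H.edgeSet, ∀ j < d, F (v E j) ∈ g E := fun E hE j hj =>
    (hmem E hE).2 _ (hv.mem E hE j hj)
  have hlt : ∀ E ∈ H.edgeSet, ∀ E' ∈ H.edgeSet, F (v E 0) < F (v E' 1) := fun E hE E' hE' =>
    hF (mem_vertexSet_of_mem_edgeSet hE (hv.mem E hE 0 (by omega)))
      (mem_vertexSet_of_mem_edgeSet hE' (hv.mem E' hE' 1 hd))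
      (hv.lt_of_lt hE hE' Nat.zero_lt_one hd)
  rcases hsep (e E) (he E hE) (g E) (hge E hE) (g E') (hEE' ▸ hge E' hE')
    (fun h => hne (hg hE hE' h)) with h | h
  · exact (h _ (hin E hE 1 hd) _ (hin E' hE' 0 (by omega))).not_gt (hlt E' hE' E hE)
  · exact (h _ (hin E hE 0 (by omega)) _ (hin E' hE' 1 hd)).not_gt (hlt E hE E' hE')

/-- The bound on the weight, for families of finite sets of natural numbers below `n`. -/
theorem exists_sum_card_le (hv : H.IsCoordinates d k v) (hd : 2 ≤ d) (hk : 0 < k) :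
    ∃ C : ℕ, ∀ n : ℕ, 0 < n → ∀ 𝒢 : Finset (Finset ℕ), (∀ E ∈ 𝒢, ∀ x ∈ E, x < n) →
      ¬ H.ContainedIn 𝒢 → ∑ E ∈ 𝒢, #E ≤ C * n ^ (d - 1) := by
  have : NeZero d := ⟨by omega⟩
  choose C hC using hv.exists_card_le_of_uniform
  obtain ⟨p, hp⟩ : ∃ p, p = k * d := ⟨_, rfl⟩
  have hp0 : 0 < p := hp ▸ Nat.mul_pos hk (by omega)
  refine ⟨p * ∑ s ∈ range p, C s + 2 * p * (k * C p), fun n hn 𝒢 h𝒢 hnot => ?_⟩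
  -- With `p` the number of vertices of `H`, the sets with fewer than `p` elements are
  -- counted for each size separately.
  have hsmall : ∑ E ∈ 𝒢 with #E < p, #E ≤ p * ((∑ s ∈ range p, C s) * n ^ (d - 1)) := by
    have h1 : #(𝒢.filter fun E => #E < p) ≤ (∑ s ∈ range p, C s) * n ^ (d - 1) := by
      rw [card_eq_sum_card_fiberwise (f := card) (t := range p) fun E hE => by
        simpa using (mem_filter.1 hE).2, sum_mul]
      refine sum_le_sum fun s _ => hC s n hn _ (fun E hE => ?_) fun h =>
        hnot (h.mono ((filter_subset _ _).trans (filter_subset _ _)))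
      simp only [mem_filter] at hE
      exact ⟨hE.2, h𝒢 E hE.1.1⟩
    refine (sum_le_card_nsmul _ _ p fun E hE => (mem_filter.1 hE).2.le).trans ?_
    rw [smul_eq_mul, mul_comm]
    exact Nat.mul_le_mul_left p h1
  choose 𝒯 h𝒯 hsep hcard using fun E : Finset ℕ => exists_pieces hp0 E
  set 𝒢' := 𝒢.filter fun E => ¬ #E < p
  have hnot' : ¬ H.ContainedIn 𝒢' := fun h => hnot (h.mono (filter_subset _ _))
  have hpieces : #(𝒢'.biUnion 𝒯) ≤ C p * n ^ (d - 1) := by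
    refine hC p n hn _ (fun T hT => ?_) (hv.not_containedIn_biUnion hd hnot' 𝒯
      (fun E _ T hT => (h𝒯 E T hT).1) fun E _ => hsep E)
    obtain ⟨E, hE, hTE⟩ := mem_biUnion.1 hT
    exact ⟨(h𝒯 E T hTE).2, fun x hx => h𝒢 E (mem_filter.1 hE).1 x ((h𝒯 E T hTE).1 hx)⟩
  -- A piece is a piece of fewer than `k` sets.
  have hmult : ∑ E ∈ 𝒢', #(𝒯 E) ≤ k * #(𝒢'.biUnion 𝒯) := by
    calc ∑ E ∈ 𝒢', #(𝒯 E)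
        = ∑ E ∈ 𝒢', #((𝒢'.biUnion 𝒯).bipartiteAbove (fun E T => T ∈ 𝒯 E) E) := by
          refine sum_congr rfl fun E hE => congrArg card ?_
          ext T
          simp only [bipartiteAbove, mem_filter, mem_biUnion]
          exact ⟨fun h => ⟨⟨E, hE, h⟩, h⟩, fun h => h.2⟩
      _ = ∑ T ∈ 𝒢'.biUnion 𝒯, #(𝒢'.bipartiteBelow (fun E T => T ∈ 𝒯 E) T) :=
          sum_card_bipartiteAbove_eq_sum_card_bipartiteBelow _
      _ ≤ #(𝒢'.biUnion 𝒯) • k := by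
          refine sum_le_card_nsmul _ _ k fun T hT => ?_
          obtain ⟨E, hE, hTE⟩ := mem_biUnion.1 hT
          refine (card_le_card fun E' hE' => ?_).trans
            (hv.card_filter_superset_lt hnot' (hp ▸ (h𝒯 E T hTE).2)).le
          simp only [bipartiteBelow, mem_filter] at hE' ⊢
          exact ⟨hE'.1, (h𝒯 E' T hE'.2).1⟩
      _ = k * #(𝒢'.biUnion 𝒯) := by rw [smul_eq_mul, mul_comm]
  have hlarge : ∑ E ∈ 𝒢', #E ≤ 2 * p * (k * (C p * n ^ (d - 1))) := by
    calc ∑ E ∈ 𝒢', #E ≤ ∑ E ∈ 𝒢', 2 * p * #(𝒯 E) := by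
          refine sum_le_sum fun E hE => ?_
          have h1 := hcard E
          have h2 : p ≤ #E := not_lt.1 (mem_filter.1 hE).2
          -- There is at least one piece, so the remainder costs at most a factor `2`.
          have h3 : 0 < #(𝒯 E) := by
            by_contra! h0
            rw [Nat.le_zero.1 h0] at h1
            omega
          nlinarith
      _ = 2 * p * ∑ E ∈ 𝒢', #(𝒯 E) := (mul_sum _ _ _).symm
      _ ≤ 2 * p * (k * (C p * n ^ (d - 1))) :=
          Nat.mul_le_mul_left _ (hmult.trans (Nat.mul_le_mul_left k hpieces))
  rw [← sum_filter_add_sum_filter_not 𝒢 fun E => #E < p]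
  calc _ ≤ _ := Nat.add_le_add hsmall hlarge
    _ = _ := by ring

end IsCoordinates

/-! ### Passage to families of finite sets -/

theorem contains_of_containedIn {G H : Hypergraph ℕ} {𝒢 : Finset (Finset ℕ)}
    (h𝒢 : ∀ E ∈ 𝒢, (E : Set ℕ) ∈ G.edgeSet) (hH : ∀ w ∈ H.vertexSet, ∃ E ∈ H.edgeSet, w ∈ E)
    (h : H.ContainedIn 𝒢) : G.Contains H := by
  obtain ⟨F, hF, g, hg, hmem⟩ := h
  have hFG : ∀ w ∈ H.vertexSet, F w ∈ G.vertexSet := fun w hw => by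
    obtain ⟨E, hE, hwE⟩ := hH w hw
    exact mem_vertexSet_of_mem_edgeSet (h𝒢 _ (hmem E hE).1) (mem_coe.2 ((hmem E hE).2 w hwE))
  exact ⟨OrderEmbedding.ofStrictMono (fun w => ⟨F w, hFG w w.2⟩) fun w w' hww' =>
      hF w.2 w'.2 hww',
    ⟨fun E => ⟨g E, h𝒢 _ (hmem E E.2).1⟩, fun E E' hEE' => Subtype.ext <| hg E.2 E'.2 <|
      coe_injective (congrArg Subtype.val hEE')⟩,
    fun E w hw => mem_coe.2 ((hmem E E.2).2 w hw)⟩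

/-- The edges of a hypergraph on `[n]`, as a finite family of finite sets of numbers below
`n + 1`. -/
theorem exists_finset_family {G : Hypergraph ℕ} {n : ℕ} (hG : G.vertexSet = Set.Icc 1 n) :
    ∃ 𝒢 : Finset (Finset ℕ), (∀ E ∈ 𝒢, (E : Set ℕ) ∈ G.edgeSet) ∧
      (∀ E ∈ 𝒢, ∀ x ∈ E, x < n + 1) ∧ G.weight = ∑ E ∈ 𝒢, #E := by
  classical
  have hfin : ∀ E ∈ G.edgeSet, E ⊆ (Finset.Icc 1 n : Finset ℕ) := fun E hE => by
    rw [coe_Icc, ← hG]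
    exact G.subset_vertexSet_of_mem_edgeSet' hE
  let 𝒢 : Finset (Finset ℕ) := (Icc 1 n).powerset.filter fun E => (E : Set ℕ) ∈ G.edgeSet
  refine ⟨𝒢, fun E hE => (mem_filter.1 hE).2, fun E hE x hx => ?_, ?_⟩
  · have := mem_Icc.1 (mem_powerset.1 (mem_filter.1 hE).1 hx)
    omega
  · let c : Finset ℕ ↪ Set ℕ := ⟨fun E => (E : Set ℕ), coe_injective⟩
    have hedge : G.edgeSet = (𝒢.map c : Finset (Set ℕ)) := by
      ext E
      simp only [c, coe_map, Function.Embedding.coeFn_mk, Set.mem_image, mem_coe, 𝒢, mem_filter,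
        mem_powerset]
      refine ⟨fun hE => ?_, ?_⟩
      · obtain ⟨T, rfl⟩ := ((Icc 1 n).finite_toSet.subset (hfin E hE)).exists_finset_coe
        exact ⟨T, ⟨coe_subset.1 (hfin _ hE), hE⟩, rfl⟩
      · rintro ⟨T, ⟨-, hT⟩, rfl⟩
        exact hT
    rw [weight, hedge, finsum_mem_coe_finset, sum_map]
    exact sum_congr rfl fun E _ => Set.ncard_coe_finset E

end Hypergraph

theorem theorem5p3 (d : ℕ) (hd : 2 ≤ d) (H : Hypergraph ℕ) (hH : H.IsPermutationHypergraph d) :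
    ∃ C : ℝ, ∀ n : ℕ, 0 < n → ∀ G : Hypergraph ℕ, G.vertexSet = Set.Icc 1 n → G.Avoids H →
      (G.weight : ℝ) ≤ C * (n : ℝ) ^ (d - 1) := by
  obtain ⟨k, hk, v, hv⟩ := hH.exists_isCoordinates
  obtain ⟨C, hC⟩ := hv.exists_sum_card_le hd hk
  -- The vertices are numbers below `n + 1`, and `n + 1 ≤ 2 * n`.
  refine ⟨(C * 2 ^ (d - 1) : ℕ), fun n hn G hG hGH => ?_⟩
  obtain ⟨𝒢, hedge, hlt, hweight⟩ := Hypergraph.exists_finset_family hG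
  have hsum := hC (n + 1) n.succ_pos 𝒢 hlt fun h =>
    hGH (Hypergraph.contains_of_containedIn hedge hv.exists_mem h)
  have hpow : (n + 1) ^ (d - 1) ≤ 2 ^ (d - 1) * n ^ (d - 1) := by
    rw [← mul_pow]
    exact Nat.pow_le_pow_left (by omega) _
  have : G.weight ≤ C * 2 ^ (d - 1) * n ^ (d - 1) := by
    rw [hweight, mul_assoc]
    exact hsum.trans (Nat.mul_le_mul_left C hpow)
  exact_mod_cast this
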